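/- Let $X$ be a (Hausdorff, paracompact) complex manifold and let $E\to X$ be a holomorphic vector bundle of rank $q$, with sheaf of holomorphic sections $\mathcal E$. Let $\wedge^\bullet\mathcal E$ be the sheaf of exterior algebras, let $\mathcal J\subset\wedge^\bullet\mathcal E$ be the sheaf of ideals generated by the local sections of $E$, and let $\mathcal Aut(\wedge^\bullet\mathcal E)$ be the sheaf of groups of $\mathbb Z_2$-graded $\mathbb C$-algebra automorphisms of $\wedge^\bullet\mathcal E$. For $k\ge 2$ put $$\mathcal G^{(k)}=\{\alpha\in\mathcal Aut(\wedge^\bullet\mathcal E)\mid \alpha(u)-u\in\mathcal J^k\ \text{for all } u\},\qquad \mathcal Q^{(k)}=\mathcal G^{(k)}/\mathcal G^{(k+1)}$$ (quotient sheaf of groups). A supermanifold modelled on $(X,E)$ is an element of the pointed \v{C}ech cohomology set $\check H^1(X,\mathcal G^{(2)})$. For $k>2$, an element of $\check H^1(X,\mathcal G^{(k)})$ is called a $(k-1)$-split atlas for the supermanifold which is its image in $\check H^1(X,\mathcal G^{(2)})$; it is called exotic if its image in $H^1(X,\mathcal Q^{(k)})$ is not the base point, while its image in $\check H^1(X,\mathcal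 G^{(2)})$ is the base point. If $H^0(X,\mathcal Q^{(k)})=(0)$ for all $k\ge 2$, then no supermanifold modelled on $(X,E)$ admits an exotic atlas. Moreover, it suffices that $H^0(X,\mathcal Q^{(k)})=(0)$ for all $k$ with $2\le k<q$. -/

import Mathlib

open CategoryTheory TopologicalSpace Opposite Bundle
open scoped Manifold ContDiff

universe u v

/-! ## Čech cohomology in degree one with values in a presheaf of (nonabelian) groups -/

namespace CechOne

/-- An open cover of `X`, indexed by a type in the universe of `X`
(these are cofinal among all open covers). -/
structure OpenCover (X : Type u) [TopologicalSpace X] where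
  ι : Type u
  U : ι → Opens X
  covers : ∀ x : X, ∃ i, x ∈ U i

section

variable {X : Type u} [TopologicalSpace X]

/-- The cover of `X` by the single open set `X`. -/
def OpenCover.trivial (X : Type u) [TopologicalSpace X] : OpenCover X where
  ι := PUnit
  U _ := ⊤
  covers _ := ⟨PUnit.unit, Opens.mem_top _⟩

/-- The cover by the pairwise intersections of two covers. -/
def OpenCover.inf (𝒰 𝒱 : OpenCover X) : OpenCover X where
  ι := 𝒰.ι × 𝒱.ι
  U p := 𝒰.U p.1 ⊓ 𝒱.U p.2
  covers x := by
    obtain ⟨i, hi⟩ := 𝒰.covers x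
    obtain ⟨j, hj⟩ := 𝒱.covers x
    exact ⟨(i, j), hi, hj⟩

/-- A refinement map from the cover `𝒲` to the cover `𝒰`. -/
structure Refinement (𝒲 𝒰 : OpenCover X) where
  τ : 𝒲.ι → 𝒰.ι
  le : ∀ j, 𝒲.U j ≤ 𝒰.U (τ j)

/-- Composition of refinement maps. -/
def Refinement.comp {𝒱 𝒲 𝒰 : OpenCover X} (s : Refinement 𝒱 𝒲) (r : Refinement 𝒲 𝒰) :
    Refinement 𝒱 𝒰 where
  τ j := r.τ (s.τ j)
  le j := (s.le j).trans (r.le (s.τ j))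

/-- The identity refinement. -/
def Refinement.refl (𝒰 : OpenCover X) : Refinement 𝒰 𝒰 := ⟨id, fun _ => le_rfl⟩

/-- The first projection of an intersection cover. -/
def Refinement.fst (𝒰 𝒱 : OpenCover X) : Refinement (𝒰.inf 𝒱) 𝒰 := ⟨Prod.fst, fun _ => inf_le_left⟩

/-- The second projection of an intersection cover. -/
def Refinement.snd (𝒰 𝒱 : OpenCover X) : Refinement (𝒰.inf 𝒱) 𝒱 := ⟨Prod.snd, fun _ => inf_le_right⟩

variable (G : (Opens X)ᵒᵖ ⥤ GrpCat.{max u v})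

/-- Čech 1-cocycles with values in `G` on some open cover. -/
structure Cocycle where
  cover : OpenCover X
  cocycle : PresheafOfGroups.OneCocycle G cover.U

variable {G}

/-- The pullback of a 1-cocycle along a refinement map. -/
def pullback {𝒲 𝒰 : OpenCover X} (r : Refinement 𝒲 𝒰)
    (γ : PresheafOfGroups.OneCocycle G 𝒰.U) : PresheafOfGroups.OneCocycle G 𝒲.U where
  ev i j _ a b := γ.ev (r.τ i) (r.τ j) (a ≫ homOfLE (r.le i)) (b ≫ homOfLE (r.le j))
  ev_precomp i j _ _ φ a b := by
    simp
  ev_trans i j k _ a b c := γ.ev_trans _ _ _ _ _ _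

theorem pullback_comp {𝒱 𝒲 𝒰 : OpenCover X} (s : Refinement 𝒱 𝒲) (r : Refinement 𝒲 𝒰)
    (γ : PresheafOfGroups.OneCocycle G 𝒰.U) :
    pullback s (pullback r γ) = pullback (s.comp r) γ := rfl

theorem isCohomologous_pullback {𝒲 𝒰 : OpenCover X} (r : Refinement 𝒲 𝒰)
    {γ γ' : PresheafOfGroups.OneCocycle G 𝒰.U} (h : γ.IsCohomologous γ') :
    (pullback r γ).IsCohomologous (pullback r γ') := by
  obtain ⟨α, hα⟩ := h
  refine ⟨fun i => G.map (homOfLE (r.le i)).op (α (r.τ i)), fun i j T a b => ?_⟩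
  have := hα (r.τ i) (r.τ j) (a ≫ homOfLE (r.le i)) (b ≫ homOfLE (r.le j))
  simp only [op_comp, G.map_comp, GrpCat.comp_apply] at this
  exact this

theorem isCohomologous_pullback_pullback {𝒲 𝒰 : OpenCover X} (r s : Refinement 𝒲 𝒰)
    (γ : PresheafOfGroups.OneCocycle G 𝒰.U) :
    (pullback r γ).IsCohomologous (pullback s γ) := by
  refine ⟨fun i => γ.ev (s.τ i) (r.τ i) (homOfLE (s.le i)) (homOfLE (r.le i)),
    fun i j T a b => ?_⟩
  rw [γ.ev_precomp, γ.ev_precomp]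
  exact (γ.ev_trans _ _ _ _ _ _).trans (γ.ev_trans _ _ _ _ _ _).symm

variable (G)

/-- Two cocycles are equivalent if they become cohomologous on a common refinement. -/
def setoid : Setoid (Cocycle G) where
  r z z' := ∃ (𝒲 : OpenCover X) (r : Refinement 𝒲 z.cover) (r' : Refinement 𝒲 z'.cover),
    (pullback r z.cocycle).IsCohomologous (pullback r' z'.cocycle)
  iseqv :=
    { refl := fun z => ⟨z.cover, .refl _, .refl _,
        (PresheafOfGroups.OneCocycle.equivalence_isCohomologous _ _).refl _⟩
      symm := by
        rintro z z' ⟨𝒲, r, r', h⟩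
        exact ⟨𝒲, r', r, (PresheafOfGroups.OneCocycle.equivalence_isCohomologous _ _).symm h⟩
      trans := by
        rintro z z' z'' ⟨𝒲, r, r', h⟩ ⟨𝒱, s, s', h'⟩
        have E := PresheafOfGroups.OneCocycle.equivalence_isCohomologous G (𝒲.inf 𝒱).U
        refine ⟨𝒲.inf 𝒱, (Refinement.fst 𝒲 𝒱).comp r, (Refinement.snd 𝒲 𝒱).comp s', ?_⟩
        rw [← pullback_comp, ← pullback_comp]
        refine E.trans (isCohomologous_pullback _ h) (E.trans ?_ (isCohomologous_pullback _ h'))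
        rw [pullback_comp, pullback_comp]
        exact isCohomologous_pullback_pullback _ _ _ }

/-- The first Čech cohomology set `Ȟ¹(X, G)`: the direct limit over all open covers of the sets of
1-cocycles modulo cohomology. -/
def H1 : Type _ := Quotient (setoid G)

/-- The base point of `Ȟ¹(X, G)`: the class of the trivial cocycle. -/
def H1.base : H1 G := Quotient.mk (setoid G) ⟨.trivial X, 1⟩

variable {G} {G' : (Opens X)ᵒᵖ ⥤ GrpCat.{max u v}}

/-- The image of a cocycle under a morphism of presheaves of groups. -/
def mapCocycle (η : G ⟶ G') {𝒰 : OpenCover X} (γ : PresheafOfGroups.OneCocycle G 𝒰.U) :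
    PresheafOfGroups.OneCocycle G' 𝒰.U where
  ev i j T a b := η.app (op T) (γ.ev i j a b)
  ev_precomp i j T T' φ a b := by
    rw [← γ.ev_precomp, ← GrpCat.comp_apply, ← GrpCat.comp_apply, η.naturality]
  ev_trans i j k T a b c := by
    rw [← map_mul, γ.ev_trans]

theorem mapCocycle_isCohomologous (η : G ⟶ G') {𝒰 : OpenCover X}
    {γ γ' : PresheafOfGroups.OneCocycle G 𝒰.U} (h : γ.IsCohomologous γ') :
    (mapCocycle η γ).IsCohomologous (mapCocycle η γ') := by
  obtain ⟨α, hα⟩ := h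
  refine ⟨fun i => η.app (op (𝒰.U i)) (α i), fun i j T a b => ?_⟩
  have := congrArg (η.app (op T)) (hα i j a b)
  rw [map_mul, map_mul] at this
  rw [← GrpCat.comp_apply, ← GrpCat.comp_apply, ← η.naturality, ← η.naturality]
  exact this

/-- The map `Ȟ¹(X, G) → Ȟ¹(X, G')` induced by a morphism of presheaves of groups. -/
def H1.map (η : G ⟶ G') : H1 G → H1 G' :=
  Quotient.lift (fun z => Quotient.mk (setoid G') ⟨z.cover, mapCocycle η z.cocycle⟩) (by
    rintro z z' ⟨𝒲, r, r', h⟩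
    exact Quotient.sound ⟨𝒲, r, r', mapCocycle_isCohomologous η h⟩)

end

end CechOne

/-! ## Sheafification of presheaves of groups on a space -/

namespace GrpSheafify

theorem hasColimitsOfShape (J : Type u) [SmallCategory J] [IsFiltered J] :
    Limits.HasColimitsOfShape J GrpCat.{max u v} where
  has_colimit F := ⟨⟨⟨GrpCat.FilteredColimits.colimitCocone F,
    GrpCat.FilteredColimits.colimitCoconeIsColimit F⟩⟩⟩

theorem preservesColimitsOfShape (J : Type u) [SmallCategory J] [IsFiltered J] :
    Limits.PreservesColimitsOfShape J (forget GrpCat.{max u v}) where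
  preservesColimit {F} := Limits.preservesColimit_of_preserves_colimit_cocone
    (GrpCat.FilteredColimits.colimitCoconeIsColimit.{u, v} F)
    (Limits.Types.TypeMax.colimitCoconeIsColimit (F ⋙ forget GrpCat.{max u v}))

instance hasSheafify (X : Type u) [TopologicalSpace X] :
    HasSheafify (Opens.grothendieckTopology X) GrpCat.{max u v} := by
  have : ∀ U : Opens X, Limits.HasColimitsOfShape
      ((Opens.grothendieckTopology X).Cover U)ᵒᵖ GrpCat.{max u v} :=
    fun U => hasColimitsOfShape.{u, v} _
  have : ∀ U : Opens X, Limits.PreservesColimitsOfShape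
      ((Opens.grothendieckTopology X).Cover U)ᵒᵖ (forget GrpCat.{max u v}) :=
    fun U => preservesColimitsOfShape.{u, v} _
  infer_instance

end GrpSheafify

/-! ## The sheaf of exterior algebras of a holomorphic vector bundle -/

namespace SuperModel

noncomputable section

section

variable {X : Type u} [TopologicalSpace X]
  (V : Type*) [NormedAddCommGroup V] [NormedSpace ℂ V] [ChartedSpace V X]
  (F : Type*) [NormedAddCommGroup F] [NormedSpace ℂ F]
  (E : X → Type v) [∀ x, AddCommGroup (E x)] [∀ x, Module ℂ (E x)]

/-- Arbitrary (not necessarily holomorphic) sections over `U` of the bundle with fibres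
`⋀ (E x)`, with pointwise operations. -/
abbrev RawSection (U : Opens X) : Type (max u v) := ∀ x : U, ExteriorAlgebra ℂ (E x)

/-- Restriction of arbitrary sections. -/
def rawRes {U W : Opens X} (h : W ≤ U) : RawSection E U →ₐ[ℂ] RawSection E W where
  toFun a x := a ⟨x.1, h x.2⟩
  map_one' := rfl
  map_mul' _ _ := rfl
  map_zero' := rfl
  map_add' _ _ := rfl
  commutes' _ := rfl

/-- The holomorphic functions on `U`, as sections of `⋀ E`. -/
def holFunctions (U : Opens X) : Set (RawSection E U) :=
  {a | ∃ f : U → ℂ, ContMDiff 𝓘(ℂ, V) 𝓘(ℂ) ω f ∧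
    a = fun x : U => algebraMap ℂ (ExteriorAlgebra ℂ (E x.1)) (f x)}

variable [TopologicalSpace (TotalSpace F E)] [∀ x, TopologicalSpace (E x)] [FiberBundle F E]

/-- The holomorphic sections of `E` over `U`, as sections of `⋀ E`. -/
def holSections (U : Opens X) : Set (RawSection E U) :=
  {a | ∃ s : ∀ x : U, E x,
    ContMDiff 𝓘(ℂ, V) (𝓘(ℂ, V).prod 𝓘(ℂ, F)) ω
      (fun x : U => (TotalSpace.mk' F x.1 (s x) : TotalSpace F E)) ∧
    a = fun x : U => ExteriorAlgebra.ι ℂ (s x)}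

/-- The exterior algebra over `𝒪(U)` generated by `ℰ(U)`, inside all sections of `⋀ E`. -/
def generated (U : Opens X) : Subalgebra ℂ (RawSection E U) :=
  Algebra.adjoin ℂ (holFunctions V E U ∪ holSections V F E U)

variable {V F E}

theorem rawRes_holFunctions {U W : Opens X} (h : W ≤ U) {a : RawSection E U}
    (ha : a ∈ holFunctions V E U) : rawRes E h a ∈ holFunctions V E W := by
  obtain ⟨f, hf, rfl⟩ := ha
  exact ⟨fun x => f ⟨x.1, h x.2⟩, hf.comp (contMDiff_inclusion h), rfl⟩

theorem rawRes_holSections {U W : Opens X} (h : W ≤ U) {a : RawSection E U}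
    (ha : a ∈ holSections V F E U) : rawRes E h a ∈ holSections V F E W := by
  obtain ⟨s, hs, rfl⟩ := ha
  exact ⟨fun x => s ⟨x.1, h x.2⟩, hs.comp (contMDiff_inclusion h), rfl⟩

theorem rawRes_generated {U W : Opens X} (h : W ≤ U) {a : RawSection E U}
    (ha : a ∈ generated V F E U) : rawRes E h a ∈ generated V F E W := by
  have : generated V F E U ≤ (generated V F E W).comap (rawRes E h) := by
    refine Algebra.adjoin_le ?_
    rintro b (hb | hb)
    · exact Algebra.subset_adjoin (Or.inl (rawRes_holFunctions h hb))
    · exact Algebra.subset_adjoin (Or.inr (rawRes_holSections h hb))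
  exact this ha

variable (V F E)

/-- The algebra `(⋀ ℰ)(U)`: the sections over `U` of the exterior bundle `⋀ E` that are,
locally on `U`, polynomial expressions in holomorphic functions and holomorphic sections of `E`. -/
def Ext (U : Opens X) : Subalgebra ℂ (RawSection E U) where
  carrier := {a | ∀ x ∈ U, ∃ (W : Opens X) (h : W ≤ U), x ∈ W ∧ rawRes E h a ∈ generated V F E W}
  mul_mem' := by
    intro _ _ ha hb x hx
    obtain ⟨W, h, hxW, hW⟩ := ha x hx
    obtain ⟨W', h', hxW', hW'⟩ := hb x hx
    refine ⟨W ⊓ W', inf_le_left.trans h, ⟨hxW, hxW'⟩, ?_⟩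
    rw [map_mul]
    exact mul_mem (rawRes_generated (inf_le_left : W ⊓ W' ≤ W) hW)
      (rawRes_generated (inf_le_right : W ⊓ W' ≤ W') hW')
  add_mem' := by
    intro a b ha hb x hx
    obtain ⟨W, h, hxW, hW⟩ := ha x hx
    obtain ⟨W', h', hxW', hW'⟩ := hb x hx
    refine ⟨W ⊓ W', inf_le_left.trans h, ⟨hxW, hxW'⟩, ?_⟩
    rw [map_add]
    exact add_mem (rawRes_generated (inf_le_left : W ⊓ W' ≤ W) hW)
      (rawRes_generated (inf_le_right : W ⊓ W' ≤ W') hW')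
  algebraMap_mem' c x hx := ⟨U, le_rfl, hx, by
    rw [AlgHom.commutes]; exact (generated V F E U).algebraMap_mem c⟩

variable {V F E}

theorem rawRes_mem {U W : Opens X} (h : W ≤ U) {a : RawSection E U}
    (ha : a ∈ Ext V F E U) : rawRes E h a ∈ Ext V F E W := by
  intro x hx
  obtain ⟨W', h', hxW', hW'⟩ := ha x (h hx)
  exact ⟨W' ⊓ W, inf_le_right, ⟨hxW', hx⟩,
    rawRes_generated (inf_le_left : W' ⊓ W ≤ W') hW'⟩

theorem generated_le (U : Opens X) : generated V F E U ≤ Ext V F E U :=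
  fun _ ha _ hx => ⟨U, le_rfl, hx, ha⟩

/-- The restriction maps of `⋀ ℰ`. -/
def res {U W : Opens X} (h : W ≤ U) : Ext V F E U →ₐ[ℂ] Ext V F E W :=
  ((rawRes E h).comp (Ext V F E U).val).codRestrict _ fun a => rawRes_mem h a.2

/-- The section `a` is homogeneous of parity `i` for the `ℤ/2`-grading of `⋀ ℰ`. -/
def HasParity {U : Opens X} (i : ZMod 2) (a : Ext V F E U) : Prop :=
  ∀ x : U, a.1 x ∈ CliffordAlgebra.evenOdd (0 : QuadraticForm ℂ (E x)) i

variable (V F E)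

/-- The ideal of `(⋀ ℰ)(U)` generated by `ℰ(U)`. (The left ideal is two-sided since `⋀ ℰ` is
supercommutative.) -/
def genIdeal (U : Opens X) : Ideal (Ext V F E U) :=
  Ideal.span {a | a.1 ∈ holSections V F E U}

variable {V F E}

theorem res_genIdeal_pow {U W : Opens X} (h : W ≤ U) (k : ℕ) {a : Ext V F E U}
    (ha : a ∈ genIdeal V F E U ^ k) : res h a ∈ genIdeal V F E W ^ k := by
  have h1 : genIdeal V F E U ≤ (genIdeal V F E W).comap (res h) :=
    Ideal.span_le.2 fun b hb => Ideal.subset_span (rawRes_holSections h hb)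
  induction k generalizing a with
  | zero => rw [Submodule.pow_zero, Ideal.one_eq_top]; trivial
  | succ k ih =>
    rw [Submodule.pow_succ] at ha ⊢
    have : genIdeal V F E U ^ k * genIdeal V F E U ≤
        (genIdeal V F E W ^ k * genIdeal V F E W).comap (res h) :=
      Ideal.mul_le.2 fun r hr s hs => by
        rw [Ideal.mem_comap, map_mul]
        exact Ideal.mul_mem_mul (ih hr) (h1 hs)
    exact this ha

variable (V F E)

/-- The sections over `U` of the sheaf of ideals `𝒥ᵏ`, where `𝒥 ⊆ ⋀ ℰ` is the sheaf of ideals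
generated by the local sections of `E`. -/
def J (k : ℕ) (U : Opens X) : Ideal (Ext V F E U) where
  carrier := {a | ∀ x ∈ U, ∃ (W : Opens X) (h : W ≤ U), x ∈ W ∧ res h a ∈ genIdeal V F E W ^ k}
  zero_mem' x hx := ⟨U, le_rfl, hx, by rw [map_zero]; exact zero_mem _⟩
  add_mem' := by
    intro a b ha hb x hx
    obtain ⟨W, h, hxW, hW⟩ := ha x hx
    obtain ⟨W', h', hxW', hW'⟩ := hb x hx
    refine ⟨W ⊓ W', inf_le_left.trans h, ⟨hxW, hxW'⟩, ?_⟩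
    rw [map_add]
    exact add_mem (res_genIdeal_pow (inf_le_left : W ⊓ W' ≤ W) k hW)
      (res_genIdeal_pow (inf_le_right : W ⊓ W' ≤ W') k hW')
  smul_mem' := by
    intro c a ha x hx
    obtain ⟨W, h, hxW, hW⟩ := ha x hx
    refine ⟨W, h, hxW, ?_⟩
    rw [smul_eq_mul, map_mul]
    exact Ideal.mul_mem_left _ _ hW

variable {V F E}

theorem res_J {U W : Opens X} (h : W ≤ U) (k : ℕ) {a : Ext V F E U}
    (ha : a ∈ J V F E k U) : res h a ∈ J V F E k W := by
  intro x hx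
  obtain ⟨W', h', hxW', hW'⟩ := ha x (h hx)
  exact ⟨W' ⊓ W, inf_le_right, ⟨hxW', hx⟩,
    res_genIdeal_pow (inf_le_left : W' ⊓ W ≤ W') k hW'⟩

theorem J_local {U : Opens X} (k : ℕ) {a : Ext V F E U}
    (ha : ∀ x ∈ U, ∃ (W : Opens X) (h : W ≤ U), x ∈ W ∧ res h a ∈ J V F E k W) :
    a ∈ J V F E k U := by
  intro x hx
  obtain ⟨W, h, hxW, hW⟩ := ha x hx
  obtain ⟨W', h', hxW', hW'⟩ := hW x hxW
  exact ⟨W', h'.trans h, hxW', hW'⟩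

theorem genIdeal_pow_le_J (k : ℕ) (U : Opens X) : genIdeal V F E U ^ k ≤ J V F E k U :=
  fun _ ha _ hx => ⟨U, le_rfl, hx, ha⟩

theorem mul_mem_J {U : Opens X} {k : ℕ} {a b : Ext V F E U}
    (ha : a ∈ J V F E k U) (hb : b ∈ J V F E 1 U) : a * b ∈ J V F E (k + 1) U := by
  intro x hx
  obtain ⟨W, h, hxW, hW⟩ := ha x hx
  obtain ⟨W', h', hxW', hW'⟩ := hb x hx
  refine ⟨W ⊓ W', inf_le_left.trans h, ⟨hxW, hxW'⟩, ?_⟩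
  rw [map_mul, Submodule.pow_succ]
  refine Ideal.mul_mem_mul (res_genIdeal_pow (inf_le_left : W ⊓ W' ≤ W) k hW) ?_
  have := res_genIdeal_pow (inf_le_right : W ⊓ W' ≤ W') 1 hW'
  rwa [Submodule.pow_one] at this

theorem J_succ_le {U : Opens X} (k : ℕ) : J V F E (k + 1) U ≤ J V F E k U := by
  have key : ∀ (W : Opens X) (k : ℕ), genIdeal V F E W ^ (k + 1) ≤ genIdeal V F E W ^ k := by
    intro W k
    induction k with
    | zero => rw [Submodule.pow_zero, Ideal.one_eq_top]; exact le_top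
    | succ k ih =>
      rw [Submodule.pow_succ, Submodule.pow_succ (n := k)]
      exact Ideal.mul_le.2 fun r hr s hs => Ideal.mul_mem_mul (ih hr) hs
  intro a ha x hx
  obtain ⟨W, h, hxW, hW⟩ := ha x hx
  exact ⟨W, h, hxW, key W k hW⟩

theorem J_antitone {U : Opens X} {k l : ℕ} (h : k ≤ l) : J V F E l U ≤ J V F E k U := by
  induction l, h using Nat.le_induction with
  | base => exact le_rfl
  | succ l _ ih => exact (J_succ_le l).trans ih

/-- The projection of `⋀ M` to degree zero kills elements of odd degree. -/
theorem algebraMapInv_of_odd {M : Type*} [AddCommGroup M] [Module ℂ M] {v : ExteriorAlgebra ℂ M}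
    (hv : v ∈ CliffordAlgebra.evenOdd (0 : QuadraticForm ℂ M) 1) :
    ExteriorAlgebra.algebraMapInv v = 0 := by
  have h1 : (ExteriorAlgebra.algebraMapInv (R := ℂ) (M := M)).comp
      (CliffordAlgebra.involute (Q := (0 : QuadraticForm ℂ M))) =
      ExteriorAlgebra.algebraMapInv := by
    refine ExteriorAlgebra.hom_ext ?_
    ext m
    have : CliffordAlgebra.involute (ExteriorAlgebra.ι ℂ m) = - ExteriorAlgebra.ι ℂ m :=
      CliffordAlgebra.involute_ι m
    simp [ExteriorAlgebra.algebraMapInv, this]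
  have h2 := DFunLike.congr_fun h1 v
  rw [AlgHom.comp_apply, CliffordAlgebra.involute_eq_of_mem_odd hv, map_neg] at h2
  exact self_eq_neg.1 h2.symm

theorem algebraMapInv_genIdeal {U : Opens X} {j : Ext V F E U} (hj : j ∈ genIdeal V F E U)
    (x : U) : ExteriorAlgebra.algebraMapInv (j.1 x) = 0 := by
  induction hj using Submodule.span_induction with
  | mem a ha =>
    obtain ⟨s, -, hs⟩ := ha
    rw [hs]
    simp [ExteriorAlgebra.algebraMapInv]
  | zero => exact map_zero _
  | add a b _ _ ha hb =>
    have : (a + b).1 x = a.1 x + b.1 x := rfl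
    rw [this, map_add, ha, hb, add_zero]
  | smul c a _ ha =>
    have : (c • a).1 x = c.1 x * a.1 x := rfl
    rw [this, map_mul, ha, mul_zero]

/-- Every element of the algebra generated by functions and sections of `E` is the sum of a
function and an element of the ideal generated by sections of `E`. -/
theorem exists_add_of_generated {U : Opens X} {a : RawSection E U} (ha : a ∈ generated V F E U) :
    ∃ f ∈ holFunctions V E U, ∃ j ∈ genIdeal V F E U, a = f + j.1 := by
  induction ha using Algebra.adjoin_induction with
  | mem a ha =>
    rcases ha with ha | ha
    · exact ⟨a, ha, 0, zero_mem _, by simp⟩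
    · refine ⟨0, ⟨0, contMDiff_const, ?_⟩,
        ⟨a, generated_le U (Algebra.subset_adjoin (Or.inr ha))⟩, Ideal.subset_span ha, by simp⟩
      funext x
      simp
  | algebraMap c => exact ⟨_, ⟨fun _ => c, contMDiff_const, rfl⟩, 0, zero_mem _, by
      simp; rfl⟩
  | add a b _ _ iha ihb =>
    obtain ⟨_, ⟨f, hf, rfl⟩, j, hj, rfl⟩ := iha
    obtain ⟨_, ⟨g, hg, rfl⟩, l, hl, rfl⟩ := ihb
    refine ⟨_, ⟨f + g, hf.add hg, rfl⟩, j + l, add_mem hj hl, ?_⟩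
    funext x
    simp
    abel
  | mul a b _ _ iha ihb =>
    obtain ⟨_, ⟨f, hf, rfl⟩, j, hj, rfl⟩ := iha
    obtain ⟨_, ⟨g, hg, rfl⟩, l, hl, rfl⟩ := ihb
    have key : ∀ f : U → ℂ, ContMDiff 𝓘(ℂ, V) 𝓘(ℂ) ω f →
        (fun x : U => algebraMap ℂ (ExteriorAlgebra ℂ (E x.1)) (f x)) ∈ Ext V F E U :=
      fun f hf => generated_le U (Algebra.subset_adjoin (Or.inl ⟨f, hf, rfl⟩))
    refine ⟨_, ⟨f * g, hf.mul hg, rfl⟩,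
      (⟨_, key f hf⟩ + j) * l + ⟨_, key g hg⟩ * j, add_mem (Ideal.mul_mem_left _ _ hl)
        (Ideal.mul_mem_left _ _ hj), ?_⟩
    funext x
    simp only [Pi.mul_apply, Pi.add_apply, map_mul, AddMemClass.coe_add, MulMemClass.coe_mul]
    rw [Algebra.commutes (g x) (j.1 x)]
    noncomm_ring

/-- Odd sections of `⋀ ℰ` lie in `𝒥`. -/
theorem mem_J_of_odd {U : Opens X} {a : Ext V F E U} (ha : HasParity 1 a) :
    a ∈ J V F E 1 U := by
  intro x hx
  obtain ⟨W, h, hxW, hW⟩ := a.2 x hx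
  refine ⟨W, h, hxW, ?_⟩
  rw [Submodule.pow_one]
  obtain ⟨_, ⟨f, hf, rfl⟩, j, hj, e⟩ := exists_add_of_generated hW
  have hf0 : ∀ y : W, f y = 0 := by
    intro y
    have e1 := congrArg ExteriorAlgebra.algebraMapInv (congrFun e y)
    rw [Pi.add_apply, map_add, algebraMapInv_genIdeal hj, ExteriorAlgebra.algebraMap_leftInverse,
      add_zero] at e1
    rw [← e1]
    exact algebraMapInv_of_odd (ha ⟨y.1, h y.2⟩)
  have : res h a = j := by
    refine Subtype.ext (e.trans ?_)
    funext y
    simp [hf0]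
  rwa [this]

theorem holSections_odd {U : Opens X} {a : Ext V F E U} (ha : a.1 ∈ holSections V F E U) :
    HasParity 1 a := by
  obtain ⟨s, -, hs⟩ := ha
  intro x
  rw [hs]
  exact CliffordAlgebra.ι_mem_evenOdd_one _ _

variable (V F E)

/-! ### Green's sheaves of automorphism groups -/

/-- The sections over `U` of the sheaf of groups `𝒜ut(⋀ ℰ)`: automorphisms of the sheaf of
`ℂ`-algebras `⋀ ℰ|_U` that preserve the `ℤ/2`-grading. -/
def Aut (U : Opens X) :
    Subgroup (∀ W : {W : Opens X // W ≤ U}, Ext V F E W.1 ≃ₐ[ℂ] Ext V F E W.1) where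
  carrier := {α |
    (∀ (W W' : {W : Opens X // W ≤ U}) (h : W'.1 ≤ W.1) (u : Ext V F E W.1),
      res h (α W u) = α W' (res h u)) ∧
    ∀ (W : {W : Opens X // W ≤ U}) (i : ZMod 2) (u : Ext V F E W.1),
      HasParity i (α W u) ↔ HasParity i u}
  one_mem' := ⟨fun _ _ _ _ => rfl, fun _ _ _ => Iff.rfl⟩
  mul_mem' := by
    rintro α β ⟨hα, hα'⟩ ⟨hβ, hβ'⟩
    refine ⟨fun W W' h u => ?_, fun W i u => ?_⟩
    · rw [Pi.mul_apply, Pi.mul_apply, AlgEquiv.mul_apply, AlgEquiv.mul_apply, hα, hβ]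
    · rw [Pi.mul_apply, AlgEquiv.mul_apply, hα', hβ']
  inv_mem' := by
    rintro α ⟨hα, hα'⟩
    have e : ∀ W u, α W ((α⁻¹) W u) = u := fun W u => (α W).apply_symm_apply u
    refine ⟨fun W W' h u => (α W').injective ?_, fun W i u => ?_⟩
    · rw [← hα, e, e]
    · rw [← hα', e]

variable {V F E}

theorem aut_mem_J {U : Opens X} (α : Aut V F E U) (k : ℕ) (W : {W : Opens X // W ≤ U})
    {u : Ext V F E W.1} (hu : u ∈ J V F E k W.1) : α.1 W u ∈ J V F E k W.1 := by
  have h1 : ∀ (W : {W : Opens X // W ≤ U}) (u : Ext V F E W.1), u ∈ genIdeal V F E W.1 →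
      α.1 W u ∈ J V F E 1 W.1 := by
    intro W u hu
    have : genIdeal V F E W.1 ≤ (J V F E 1 W.1).comap (α.1 W) :=
      Ideal.span_le.2 fun b hb => mem_J_of_odd ((α.2.2 W 1 b).2 (holSections_odd hb))
    exact this hu
  have h2 : ∀ (k : ℕ) (W : {W : Opens X // W ≤ U}) (u : Ext V F E W.1),
      u ∈ genIdeal V F E W.1 ^ k → α.1 W u ∈ J V F E k W.1 := by
    intro k
    induction k with
    | zero =>
      intro W u _ x hx
      refine ⟨W.1, le_rfl, hx, ?_⟩
      rw [Submodule.pow_zero, Ideal.one_eq_top]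
      trivial
    | succ k ih =>
      intro W u hu
      rw [Submodule.pow_succ] at hu
      have : genIdeal V F E W.1 ^ k * genIdeal V F E W.1 ≤
          (J V F E (k + 1) W.1).comap (α.1 W) :=
        Ideal.mul_le.2 fun r hr s hs => by
          rw [Ideal.mem_comap, map_mul]
          exact mul_mem_J (ih W r hr) (h1 W s hs)
      exact this hu
  refine J_local k fun x hx => ?_
  obtain ⟨W', h, hxW, hW⟩ := hu x hx
  refine ⟨W', h, hxW, ?_⟩
  rw [α.2.1 W ⟨W', h.trans W.2⟩ h u]
  exact h2 k ⟨W', h.trans W.2⟩ _ hW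

variable (V F E)

/-- The sections over `U` of Green's sheaf of groups
`𝒢⁽ᵏ⁾ = {α ∈ 𝒜ut(⋀ ℰ) ∣ α(u) - u ∈ 𝒥ᵏ}`. -/
def Green (k : ℕ) (U : Opens X) : Subgroup (Aut V F E U) where
  carrier := {α | ∀ (W : {W : Opens X // W ≤ U}) (u : Ext V F E W.1),
    α.1 W u - u ∈ J V F E k W.1}
  one_mem' W u := by
    have : (1 : Aut V F E U).1 W u = u := rfl
    rw [this, sub_self]
    exact zero_mem _
  mul_mem' := by
    intro α β hα hβ W u
    have e : (α * β).1 W u - u = (α.1 W (β.1 W u) - β.1 W u) + (β.1 W u - u) := by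
      rw [sub_add_sub_cancel]; rfl
    rw [e]
    exact add_mem (hα W _) (hβ W _)
  inv_mem' := by
    intro α hα W u
    have e : α.1 W ((α⁻¹).1 W u) = u := (α.1 W).apply_symm_apply u
    have := hα W ((α⁻¹).1 W u)
    rw [e] at this
    rw [← neg_sub]
    exact neg_mem this

variable {V F E}

theorem Green_antitone {k l : ℕ} (h : k ≤ l) (U : Opens X) : Green V F E l U ≤ Green V F E k U :=
  fun _ hα W u => J_antitone h (hα W u)

instance Green_normal (k : ℕ) (U : Opens X) : (Green V F E k U).Normal where
  conj_mem := by
    intro β hβ α W u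
    have e : (α * β * α⁻¹).1 W u - u = α.1 W (β.1 W ((α⁻¹).1 W u) - (α⁻¹).1 W u) := by
      rw [map_sub]
      have : α.1 W ((α⁻¹).1 W u) = u := (α.1 W).apply_symm_apply u
      rw [this]
      rfl
    rw [e]
    exact aut_mem_J α k W (hβ W _)

/-- Restriction of automorphisms of `⋀ ℰ` to a smaller open set. -/
def autRes {U U' : Opens X} (h : U' ≤ U) : Aut V F E U →* Aut V F E U' where
  toFun α := ⟨fun W => α.1 ⟨W.1, W.2.trans h⟩,
    fun W W' => α.2.1 ⟨W.1, W.2.trans h⟩ ⟨W'.1, W'.2.trans h⟩,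
    fun W => α.2.2 ⟨W.1, W.2.trans h⟩⟩
  map_one' := rfl
  map_mul' _ _ := rfl

theorem autRes_mem {k : ℕ} {U U' : Opens X} (h : U' ≤ U) {α : Aut V F E U}
    (hα : α ∈ Green V F E k U) : autRes h α ∈ Green V F E k U' :=
  fun W => hα ⟨W.1, W.2.trans h⟩

/-- Restriction of sections of `𝒢⁽ᵏ⁾`. -/
def greenRes (k : ℕ) {U U' : Opens X} (h : U' ≤ U) : Green V F E k U →* Green V F E k U' :=
  ((autRes h).comp (Green V F E k U).subtype).codRestrict _ fun α => autRes_mem h α.2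

variable (V F E)

/-- The sheaf of groups `𝒢⁽ᵏ⁾` on `X`. -/
def greenSheaf (k : ℕ) : (Opens X)ᵒᵖ ⥤ GrpCat.{max u v} where
  obj U := GrpCat.of (Green V F E k U.unop)
  map f := GrpCat.ofHom (greenRes k (leOfHom f.unop))
  map_id _ := rfl
  map_comp _ _ := rfl

/-- The inclusion `𝒢⁽ˡ⁾ → 𝒢⁽ᵏ⁾` for `k ≤ l`. -/
def greenIncl {k l : ℕ} (h : k ≤ l) : greenSheaf V F E l ⟶ greenSheaf V F E k where
  app U := GrpCat.ofHom (Subgroup.inclusion (Green_antitone h U.unop))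
  naturality _ _ _ := rfl

/-- The presheaf quotient `U ↦ 𝒢⁽ᵏ⁾(U) / 𝒢⁽ᵏ⁺¹⁾(U)`. -/
def quotientPresheaf (k : ℕ) : (Opens X)ᵒᵖ ⥤ GrpCat.{max u v} where
  obj U := GrpCat.of
    (Green V F E k U.unop ⧸ (Green V F E (k + 1) U.unop).subgroupOf (Green V F E k U.unop))
  map f := GrpCat.ofHom (QuotientGroup.map _ _ (greenRes k (leOfHom f.unop))
    fun _ hα => autRes_mem (leOfHom f.unop) hα)
  map_id _ := by
    ext α
    rfl
  map_comp f g := by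
    ext α
    rfl

/-- The `k`-th obstruction sheaf `𝒬⁽ᵏ⁾ = 𝒢⁽ᵏ⁾ / 𝒢⁽ᵏ⁺¹⁾`: the quotient sheaf of groups. -/
def obstructionSheaf (k : ℕ) : Sheaf (Opens.grothendieckTopology X) GrpCat.{max u v} :=
  (presheafToSheaf (Opens.grothendieckTopology X) GrpCat.{max u v}).obj (quotientPresheaf V F E k)

/-- The projection `𝒢⁽ᵏ⁾ → 𝒬⁽ᵏ⁾`. -/
def obstructionProj (k : ℕ) : greenSheaf V F E k ⟶ (obstructionSheaf V F E k).obj :=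
  (show greenSheaf V F E k ⟶ quotientPresheaf V F E k from
    { app := fun _ => GrpCat.ofHom (QuotientGroup.mk' _)
      naturality := fun _ _ _ => rfl }) ≫
  toSheafify (Opens.grothendieckTopology X) (quotientPresheaf V F E k)

/-- The group `H⁰(X, 𝒬⁽ᵏ⁾)` of global sections of the `k`-th obstruction sheaf. -/
abbrev H0Obstruction (k : ℕ) : GrpCat.{max u v} := (obstructionSheaf V F E k).obj.obj (op ⊤)

/-- The `k`-th obstruction space `H¹(X, 𝒬⁽ᵏ⁾)`, as a pointed Čech cohomology set. -/
abbrev ObstructionSpace (k : ℕ) := CechOne.H1.{u, v} (obstructionSheaf V F E k).obj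

/-! ### Supermanifolds and atlases -/

/-- The `(k-1)`-split atlases for supermanifolds modelled on `(X, E)`: the elements of
`Ȟ¹(X, 𝒢⁽ᵏ⁾)`. -/
abbrev SplitAtlas (k : ℕ) := CechOne.H1.{u, v} (greenSheaf V F E k)

/-- The supermanifolds modelled on `(X, E)`: the elements of `Ȟ¹(X, 𝒢⁽²⁾)`. -/
abbrev Supermanifold := SplitAtlas V F E 2

variable {V F E}

/-- The supermanifold associated to a `(k-1)`-split atlas. -/
def SplitAtlas.toSupermanifold {k : ℕ} (hk : 2 ≤ k) (a : SplitAtlas V F E k) :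
    Supermanifold V F E :=
  CechOne.H1.map (greenIncl V F E hk) a

/-- The primary obstruction of a `(k-1)`-split atlas, in the `k`-th obstruction space. -/
def SplitAtlas.primaryObstruction {k : ℕ} (a : SplitAtlas V F E k) : ObstructionSpace V F E k :=
  CechOne.H1.map (obstructionProj V F E k) a

/-- A `(k-1)`-split atlas is obstructed if its primary obstruction does not vanish. -/
def SplitAtlas.IsObstructed {k : ℕ} (a : SplitAtlas V F E k) : Prop :=
  SplitAtlas.primaryObstruction a ≠ CechOne.H1.base _

/-- A `(k-1)`-split atlas is strongly split if its associated supermanifold is the base point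
of `Ȟ¹(X, 𝒢⁽²⁾)`. -/
def SplitAtlas.IsStronglySplit {k : ℕ} (hk : 2 ≤ k) (a : SplitAtlas V F E k) : Prop :=
  SplitAtlas.toSupermanifold hk a = CechOne.H1.base _

/-- A `(k-1)`-split atlas, `k > 2`, is exotic if it is obstructed and strongly split. -/
def SplitAtlas.IsExotic {k : ℕ} (hk : 2 < k) (a : SplitAtlas V F E k) : Prop :=
  SplitAtlas.IsObstructed a ∧ SplitAtlas.IsStronglySplit hk.le a

/-- The supermanifold `𝔛` admits an exotic atlas. -/
def Supermanifold.AdmitsExoticAtlas (𝔛 : Supermanifold V F E) : Prop :=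
  ∃ (k : ℕ) (hk : 2 < k) (a : SplitAtlas V F E k),
    SplitAtlas.toSupermanifold hk.le a = 𝔛 ∧ SplitAtlas.IsExotic hk a

end

end

end SuperModel

/-! The inclusion `𝒢⁽ʲ⁺¹⁾ ⊆ 𝒢⁽ʲ⁾` is the kernel of the projection to `𝒬⁽ʲ⁾`. In nonabelian Čech
cohomology, the classes in `Ȟ¹(𝒢⁽ʲ⁺¹⁾)` that become trivial in `Ȟ¹(𝒢⁽ʲ⁾)` come from `H⁰(𝒬⁽ʲ⁾)`: a
trivializing cochain projects to a global section of `𝒬⁽ʲ⁾`. If that group is trivial, only the base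
point becomes trivial (`H1.eq_base_of_map_eq_base`; surjectivity onto `𝒬⁽ʲ⁾` plays no role).

A strongly split atlas in `Ȟ¹(𝒢⁽ᵏ⁾)` is trivial in `Ȟ¹(𝒢⁽²⁾)`. Lifting triviality through `𝒢⁽²⁾,
𝒢⁽³⁾, …, 𝒢⁽ᵏ⁾` shows that the atlas itself is the base point (`SplitAtlas.IsStronglySplit.eq_base`),
so its primary obstruction vanishes and it cannot be exotic.

The climb uses `𝒬⁽ʲ⁾` only for `2 ≤ j < k`. If `k ≤ q` these indices are below `q`; if `k > q` then
`𝒥ᵏ = 0`, the group `𝒢⁽ᵏ⁾` is trivial, and no climb is needed. This gives the sharper bound, of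
which the first claim is a special case. -/

/-! ### Base points in degree-one Čech cohomology. -/

namespace CechOne

variable {X : Type u} [TopologicalSpace X] {G G' : (Opens X)ᵒᵖ ⥤ GrpCat.{max u v}}

/-- A cocycle represents the base point iff it becomes a coboundary on a refinement. -/
theorem H1.mk_eq_base_iff (z : Cocycle G) :
    (Quotient.mk (setoid G) z = H1.base G) ↔
      ∃ (𝒲 : OpenCover X) (r : Refinement 𝒲 z.cover)
        (α : PresheafOfGroups.ZeroCochain G 𝒲.U),
        ∀ (i j : 𝒲.ι) (T : Opens X) (a : T ⟶ 𝒲.U i) (b : T ⟶ 𝒲.U j),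
          G.map a.op (α i) * (pullback r z.cocycle).ev i j a b = G.map b.op (α j) := by
  constructor
  · intro h
    obtain ⟨𝒲, r, _, α, hα⟩ := Quotient.exact h
    exact ⟨𝒲, r, α, fun i j T a b => (hα i j a b).trans (one_mul _)⟩
  · rintro ⟨𝒲, r, α, hα⟩
    -- Every cover refines the one-set cover carrying the trivial cocycle, so `𝒲` is already a
    -- common refinement.
    exact Quotient.sound ⟨𝒲, r, ⟨fun _ => PUnit.unit, fun _ => le_top⟩, α,
      fun i j T a b => (hα i j T a b).trans (one_mul _).symm⟩

theorem H1.map_base (η : G ⟶ G') : H1.map η (H1.base G) = H1.base G' := by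
  refine (H1.mk_eq_base_iff _).2 ⟨.trivial X, .refl _, 1, fun i j T a b => ?_⟩
  have : (pullback (Refinement.refl _) (mapCocycle η (1 : PresheafOfGroups.OneCocycle G
      (OpenCover.trivial X).U))).ev i j a b = 1 := map_one (η.app (op T)).hom
  refine (congrArg _ this).trans ?_
  simp

/-- This settles the case where `k` exceeds the rank, in which `𝒢⁽ᵏ⁾` has only trivial sections. -/
theorem H1.eq_base_of_subsingleton (hG : ∀ (U : Opens X) (g : G.obj (op U)), g = 1) (a : H1 G) :
    a = H1.base G := by
  induction a using Quotient.inductionOn with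
  | h z => exact (H1.mk_eq_base_iff z).2 ⟨z.cover, .refl _, 1, fun i j T a b => by
      rw [hG _ (_ * _), hG _ (G.map b.op _)]⟩

/-- If `Q` is a sheaf of groups without nontrivial global sections and `G'` is the kernel of
`G ⟶ Q`, then only the base point of `Ȟ¹(X, G')` maps to the base point of `Ȟ¹(X, G)`. -/
theorem H1.eq_base_of_map_eq_base (η : G' ⟶ G)
    (Q : Sheaf (Opens.grothendieckTopology X) GrpCat.{max u v}) (ρ : G ⟶ Q.obj)
    (hη : ∀ U, Function.Injective (η.app U))
    (hρ : ∀ U (g : G.obj U), ρ.app U g = 1 ↔ ∃ g', η.app U g' = g)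
    (hQ : ∀ s : Q.obj.obj (op ⊤), s = 1) {a : H1 G'} (h : H1.map η a = H1.base G) :
    a = H1.base G' := by
  induction a using Quotient.inductionOn with
  | h z =>
    obtain ⟨𝒲, r, α, hα⟩ := (H1.mk_eq_base_iff _).1 h
    have hcover : (⊤ : Opens X) ≤ iSup 𝒲.U := fun x _ => by
      obtain ⟨i, hi⟩ := 𝒲.covers x
      exact Opens.mem_iSup.2 ⟨i, hi⟩
    -- The cocycle takes values in the kernel of `ρ`, so applying `ρ` to the coboundary relation
    -- leaves the compatibility of the sections `ρ(αᵢ)` on overlaps.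
    have hcomp : ∀ (i j : 𝒲.ι) (T : Opens X) (a : T ⟶ 𝒲.U i) (b : T ⟶ 𝒲.U j),
        Q.obj.map a.op (ρ.app _ (α i)) = Q.obj.map b.op (ρ.app _ (α j)) := by
      intro i j T a b
      have h1 := congrArg (ρ.app (op T)) (hα i j T a b)
      have h2 : ρ.app (op T) ((pullback r (mapCocycle η z.cocycle)).ev i j a b) = 1 :=
        (hρ _ _).2 ⟨_, rfl⟩
      rw [map_mul] at h1
      rw [← NatTrans.naturality_apply, ← NatTrans.naturality_apply]
      refine (mul_one _).symm.trans ((congrArg _ h2.symm).trans h1)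
    obtain ⟨s, hs, -⟩ := TopCat.Sheaf.existsUnique_gluing' (X := TopCat.of X) (F := Q) 𝒲.U ⊤
      (fun i => homOfLE le_top) hcover (fun i => ρ.app _ (α i))
      (fun i j => hcomp i j _ _ _)
    -- The glued section `s` is trivial by `hQ`, hence each `ρ(αᵢ)` is trivial and `αᵢ` lifts to
    -- `G'`.
    have hα1 : ∀ i, ∃ β, η.app (op (𝒲.U i)) β = α i := fun i => (hρ _ _).1 (by
      rw [← hs i, hQ s]
      exact map_one _)
    choose β hβ using hα1
    -- Injectivity of `η` carries the coboundary relation for `α` back to the lifts `β`.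
    refine (H1.mk_eq_base_iff _).2 ⟨𝒲, r, β, fun i j T a b => hη _ ?_⟩
    rw [map_mul, NatTrans.naturality_apply, NatTrans.naturality_apply, hβ, hβ]
    exact hα i j T a b

end CechOne

/-! ### Local equality of sections identified by sheafification. -/

namespace GrpSheafify

/-- Sections of a presheaf of groups with the same image in the sheafification agree locally. -/
theorem locally_eq_of_toSheafify_eq {X : Type u} [TopologicalSpace X]
    (P : (Opens X)ᵒᵖ ⥤ GrpCat.{max u v}) {U : Opens X} (s t : P.obj (op U))
    (h : (toSheafify (Opens.grothendieckTopology X) P).app (op U) s =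
      (toSheafify (Opens.grothendieckTopology X) P).app (op U) t) (x : X) (hx : x ∈ U) :
    ∃ (W : Opens X) (i : W ⟶ U), x ∈ W ∧ P.map i.op s = P.map i.op t := by
  have : ∀ U : Opens X, Limits.HasColimitsOfShape
      ((Opens.grothendieckTopology X).Cover U)ᵒᵖ GrpCat.{max u v} :=
    fun U => hasColimitsOfShape.{u, v} _
  have : ∀ U : Opens X, Limits.PreservesColimitsOfShape
      ((Opens.grothendieckTopology X).Cover U)ᵒᵖ (forget GrpCat.{max u v}) :=
    fun U => preservesColimitsOfShape.{u, v} _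
  -- The map to the concrete double-plus sheaf factors through the abstract sheafification, so
  -- equality can be tested in `P⁺⁺`.
  have hlift := toSheafify_sheafifyLift (Opens.grothendieckTopology X)
    ((Opens.grothendieckTopology X).toSheafify P)
    ((Opens.grothendieckTopology X).sheafify_isSheaf P)
  have h1 : ((Opens.grothendieckTopology X).toSheafify P).app (op U) s =
      ((Opens.grothendieckTopology X).toSheafify P).app (op U) t := by
    rw [← hlift, NatTrans.comp_app, ConcreteCategory.comp_apply, ConcreteCategory.comp_apply, h]
  rw [GrothendieckTopology.toSheafify, GrothendieckTopology.plusMap_toPlus] at h1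
  have h2 : ((Opens.grothendieckTopology X).toPlus P).app (op U) s =
      ((Opens.grothendieckTopology X).toPlus P).app (op U) t :=
    -- `P⁺` is separated, so `P⁺ → P⁺⁺` is injective and the equality descends to `P⁺`, where it
    -- means agreement on a covering sieve.
    GrothendieckTopology.Plus.inj_of_sep _
      (fun _ S => GrothendieckTopology.Plus.sep P S) U h1
  rw [GrothendieckTopology.Plus.toPlus_eq_mk, GrothendieckTopology.Plus.toPlus_eq_mk,
    GrothendieckTopology.Plus.eq_mk_iff_exists] at h2
  obtain ⟨S, h₁, h₂, e⟩ := h2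
  obtain ⟨W, i, hi, hxW⟩ := S.2 x hx
  exact ⟨W, i, hxW, congrFun (congrArg Subtype.val e) ⟨W, i, hi⟩⟩

end GrpSheafify

/-! ### The degree filtration of an exterior algebra. -/

namespace ExteriorAlgebra

variable {K M : Type*} [Field K] [AddCommGroup M] [Module K M]

/-- The sum of the exterior powers of degree at least `n`. -/
def degreeGE (K M : Type*) [Field K] [AddCommGroup M] [Module K M] (n : ℕ) :
    Submodule K (ExteriorAlgebra K M) :=
  ⨆ m : {m : ℕ // n ≤ m}, ⋀[K]^m.1 M

theorem degreeGE_mul_le (m n : ℕ) :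
    degreeGE K M m * degreeGE K M n ≤ degreeGE K M (m + n) := by
  rw [degreeGE, degreeGE, Submodule.iSup_mul]
  refine iSup_le fun a => ?_
  rw [Submodule.mul_iSup]
  refine iSup_le fun b => ?_
  rw [exteriorPower, exteriorPower, ← pow_add]
  exact le_iSup (fun c : {c : ℕ // m + n ≤ c} => ⋀[K]^c.1 M) ⟨a.1 + b.1, add_le_add a.2 b.2⟩

theorem degreeGE_zero : degreeGE K M 0 = ⊤ := by
  refine eq_top_iff.2 fun x _ => ?_
  induction x using DirectSum.Decomposition.inductionOn fun i : ℕ => ⋀[K]^i M with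
  | zero => exact zero_mem _
  | add _ _ hx hy => exact add_mem (hx trivial) (hy trivial)
  | @homogeneous i x => exact Submodule.mem_iSup_of_mem ⟨i, Nat.zero_le i⟩ x.2

theorem ι_mem_degreeGE_one (m : M) : ExteriorAlgebra.ι K m ∈ degreeGE K M 1 := by
  refine Submodule.mem_iSup_of_mem ⟨1, le_rfl⟩ ?_
  rw [exteriorPower, pow_one]
  exact LinearMap.mem_range_self _ _

/-- The `m`-th exterior power has dimension `(finrank choose m)`, which is zero for `m` above the
rank. -/
theorem degreeGE_eq_bot [FiniteDimensional K M] {n : ℕ} (hn : Module.finrank K M < n) :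
    degreeGE K M n = ⊥ := by
  refine iSup_eq_bot.2 fun m => ?_
  rw [← Submodule.finrank_eq_zero (R := K), exteriorPower.finrank_eq,
    Nat.choose_eq_zero_of_lt (hn.trans_le m.2)]

end ExteriorAlgebra

/-! ### Vanishing above the rank and the kernel of the projection to `𝒬⁽ᵏ⁾`. -/

namespace SuperModel

section

variable {X : Type u} [TopologicalSpace X]
  {V : Type*} [NormedAddCommGroup V] [NormedSpace ℂ V] [ChartedSpace V X]
  {F : Type*} [NormedAddCommGroup F] [NormedSpace ℂ F]
  {E : X → Type v} [∀ x, AddCommGroup (E x)] [∀ x, Module ℂ (E x)]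
  [TopologicalSpace (TotalSpace F E)] [∀ x, TopologicalSpace (E x)] [FiberBundle F E]

/-- Each factor from the ideal contributes degree at least one in every fibre. This pointwise bound
makes `𝒥ᵏ` vanish above the rank without choosing local frames. -/
theorem genIdeal_pow_apply_mem {U : Opens X} (k : ℕ) {a : Ext V F E U}
    (ha : a ∈ genIdeal V F E U ^ k) (x : U) :
    a.1 x ∈ ExteriorAlgebra.degreeGE ℂ (E x) k := by
  induction k generalizing a with
  | zero => rw [ExteriorAlgebra.degreeGE_zero]; trivial
  | succ k ih =>
    rw [Submodule.pow_succ] at ha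
    induction ha using Submodule.mul_induction_on' with
    | mem_mul_mem r hr s hs =>
      refine ExteriorAlgebra.degreeGE_mul_le k 1 (Submodule.mul_mem_mul (ih hr) ?_)
      clear hr r
      induction hs using Submodule.span_induction with
      | mem b hb =>
        obtain ⟨t, -, ht⟩ := hb
        rw [ht]
        exact ExteriorAlgebra.ι_mem_degreeGE_one _
      | zero => exact zero_mem _
      | add b c _ _ hb hc => exact add_mem hb hc
      | smul c b _ hb =>
        -- The coefficient `c` is an arbitrary section of `⋀ ℰ`; multiplying by it cannot lower the
        -- degree.
        have hc : c.1 x ∈ ExteriorAlgebra.degreeGE ℂ (E x) 0 := by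
          rw [ExteriorAlgebra.degreeGE_zero]; trivial
        have := ExteriorAlgebra.degreeGE_mul_le 0 1 (Submodule.mul_mem_mul hc hb)
        rwa [zero_add] at this
    | add b _ c _ hb hc => exact add_mem hb hc

theorem J_eq_bot [FiniteDimensional ℂ F] [VectorBundle ℂ F E] {k : ℕ}
    (hk : Module.finrank ℂ F < k) {U : Opens X} {a : Ext V F E U} (ha : a ∈ J V F E k U) :
    a = 0 := by
  refine Subtype.ext (funext fun x => ?_)
  obtain ⟨W, h, hxW, hW⟩ := ha x.1 x.2
  -- A local trivialization identifies the fibre with the model `F`, so the rank bound holds in the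
  -- fibre.
  have e : F ≃ₗ[ℂ] E x.1 := (Trivialization.linearEquivAt ℂ (trivializationAt F E x.1) x.1
    (FiberBundle.mem_baseSet_trivializationAt' x.1)).symm
  have := e.finiteDimensional
  have h1 := genIdeal_pow_apply_mem k hW ⟨x.1, hxW⟩
  rw [ExteriorAlgebra.degreeGE_eq_bot (e.finrank_eq ▸ hk)] at h1
  exact (Submodule.mem_bot ℂ).1 h1

theorem Green_eq_one [FiniteDimensional ℂ F] [VectorBundle ℂ F E] {k : ℕ}
    (hk : Module.finrank ℂ F < k) {U : Opens X} (α : Green V F E k U) : α = 1 :=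
  Subtype.ext (Subtype.ext (funext fun W => AlgEquiv.ext fun u =>
    sub_eq_zero.1 (J_eq_bot hk (α.2 W u))))

/-- Belonging to `𝒢⁽ᵏ⁾` is a local condition. -/
theorem mem_Green_of_locally {k : ℕ} {U : Opens X} (α : Aut V F E U)
    (h : ∀ x ∈ U, ∃ (W : Opens X) (hW : W ≤ U), x ∈ W ∧ autRes hW α ∈ Green V F E k W) :
    α ∈ Green V F E k U := by
  intro W u
  refine J_local k fun x hx => ?_
  obtain ⟨W', hW', hxW', hα⟩ := h x (W.2 hx)
  -- `u` lives only on `W`, while the hypothesis controls `α` on open subsets of `W'`; both apply on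
  -- the intersection.
  refine ⟨W' ⊓ W.1, inf_le_right, ⟨hxW', hx⟩, ?_⟩
  rw [map_sub, α.2.1 W ⟨W' ⊓ W.1, inf_le_right.trans W.2⟩ inf_le_right]
  exact hα ⟨W' ⊓ W.1, inf_le_left⟩ _

theorem obstructionProj_app (k : ℕ) (U : Opens X) (α : Green V F E k U) :
    (obstructionProj V F E k).app (op U) α =
      (toSheafify (Opens.grothendieckTopology X) (quotientPresheaf V F E k)).app (op U)
        (QuotientGroup.mk' ((Green V F E (k + 1) U).subgroupOf (Green V F E k U)) α) := rfl

/-- Sheafifying the quotient does not enlarge the kernel: a section killed there lies locally in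
`𝒢⁽ᵏ⁺¹⁾`, and that membership is a local condition. -/
theorem obstructionProj_eq_one_iff (k : ℕ) (U : Opens X) (α : Green V F E k U) :
    (obstructionProj V F E k).app (op U) α = 1 ↔ α.1 ∈ Green V F E (k + 1) U := by
  rw [obstructionProj_app]
  constructor
  · intro h
    refine mem_Green_of_locally _ fun x hx => ?_
    obtain ⟨W, i, hxW, hi⟩ := GrpSheafify.locally_eq_of_toSheafify_eq.{u, v}
      (quotientPresheaf V F E k)
      (QuotientGroup.mk' ((Green V F E (k + 1) U).subgroupOf (Green V F E k U)) α) 1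
      (h.trans (map_one ((toSheafify (Opens.grothendieckTopology X)
        (quotientPresheaf V F E k)).app (op U)).hom).symm) x hx
    have h1 : ((greenRes k (leOfHom i) α : Green V F E k W) :
        Green V F E k W ⧸ (Green V F E (k + 1) W).subgroupOf (Green V F E k W)) = 1 :=
      hi.trans (map_one ((quotientPresheaf V F E k).map i.op).hom)
    exact ⟨W, leOfHom i, hxW, (QuotientGroup.eq_one_iff (greenRes k (leOfHom i) α)).1 h1⟩
  · intro h
    have h1 : QuotientGroup.mk' ((Green V F E (k + 1) U).subgroupOf (Green V F E k U)) α = 1 :=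
      (QuotientGroup.eq_one_iff _).2 h
    rw [h1]
    exact map_one ((toSheafify (Opens.grothendieckTopology X)
      (quotientPresheaf V F E k)).app (op U)).hom

/-! ### Lifting triviality along the filtration. -/

/-- One step of the climb. The index `l` stays fixed, so that a single atlas is followed through all
its images. -/
theorem SplitAtlas.map_greenIncl_succ_eq_base {k l : ℕ} (hkl : k + 1 ≤ l)
    (hQ : ∀ s : H0Obstruction V F E k, s = 1) {a : SplitAtlas V F E l}
    (ha : CechOne.H1.map (greenIncl V F E ((Nat.le_succ k).trans hkl)) a = CechOne.H1.base _) :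
    CechOne.H1.map (greenIncl V F E hkl) a = CechOne.H1.base _ := by
  refine CechOne.H1.eq_base_of_map_eq_base (greenIncl V F E (Nat.le_succ k))
    (obstructionSheaf V F E k) (obstructionProj V F E k)
    (fun U => Subgroup.inclusion_injective (Green_antitone (Nat.le_succ k) U.unop)) (fun U α =>
      (obstructionProj_eq_one_iff k U.unop α).trans ⟨fun h => ⟨⟨α.1, h⟩, rfl⟩, ?_⟩) hQ ?_
  · rintro ⟨β, rfl⟩
    exact β.2
  rw [← ha]
  induction a using Quotient.inductionOn with
  | h z => rfl

/-- If `𝒬⁽ʲ⁾` has no nontrivial global sections for `2 ≤ j < rank E`, then a strongly split atlas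
is the base point. -/
theorem SplitAtlas.IsStronglySplit.eq_base [FiniteDimensional ℂ F] [VectorBundle ℂ F E]
    (hQ : ∀ j : ℕ, 2 ≤ j → j < Module.finrank ℂ F → ∀ s : H0Obstruction V F E j, s = 1)
    {k : ℕ} (hk : 2 ≤ k) {a : SplitAtlas V F E k} (ha : SplitAtlas.IsStronglySplit hk a) :
    a = CechOne.H1.base _ := by
  rcases lt_or_ge (Module.finrank ℂ F) k with hqk | hkq
  · exact CechOne.H1.eq_base_of_subsingleton (fun U α => Green_eq_one (V := V) (E := E) (U := U) hqk α) a
  · have key : ∀ j : ℕ, 2 ≤ j → ∀ hjk : j ≤ k,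
        CechOne.H1.map (greenIncl V F E hjk) a = CechOne.H1.base _ := by
      intro j hj
      induction j, hj using Nat.le_induction with
      | base => exact fun _ => ha
      | succ j hj ih =>
        -- Passing from `j` to `j + 1` uses `𝒬⁽ʲ⁾`, and `j + 1 ≤ k ≤ q` is exactly `j < q`: hence
        -- the strict bound in the hypothesis.
        exact fun hjk => map_greenIncl_succ_eq_base hjk (hQ j hj (hjk.trans hkq))
          (ih ((Nat.le_succ j).trans hjk))
    -- At `j = k` the inclusion is the identity on representing cocycles.
    rw [← key k hk le_rfl]
    induction a using Quotient.inductionOn with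
    | h z => rfl

theorem Supermanifold.not_admitsExoticAtlas [FiniteDimensional ℂ F] [VectorBundle ℂ F E]
    (hQ : ∀ j : ℕ, 2 ≤ j → j < Module.finrank ℂ F → ∀ s : H0Obstruction V F E j, s = 1)
    (𝔛 : Supermanifold V F E) : ¬ 𝔛.AdmitsExoticAtlas := by
  rintro ⟨k, hk, a, -, hobs, hsplit⟩
  refine hobs ?_
  rw [SplitAtlas.primaryObstruction, hsplit.eq_base hQ hk.le]
  exact CechOne.H1.map_base _

end

end SuperModel

theorem mainTheorem4
    {X : Type u} [TopologicalSpace X] [T2Space X] [ParacompactSpace X]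
    (V : Type*) [NormedAddCommGroup V] [NormedSpace ℂ V] [FiniteDimensional ℂ V]
    [ChartedSpace V X] [IsManifold 𝓘(ℂ, V) ω X]
    (F : Type*) [NormedAddCommGroup F] [NormedSpace ℂ F] [FiniteDimensional ℂ F]
    (E : X → Type v) [∀ x, AddCommGroup (E x)] [∀ x, Module ℂ (E x)]
    [TopologicalSpace (TotalSpace F E)] [∀ x, TopologicalSpace (E x)] [FiberBundle F E]
    [VectorBundle ℂ F E] [ContMDiffVectorBundle ω F E 𝓘(ℂ, V)] :
    ((∀ k : ℕ, 2 ≤ k → ∀ s : SuperModel.H0Obstruction V F E k, s = 1) →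
      ∀ 𝔛 : SuperModel.Supermanifold V F E, ¬ 𝔛.AdmitsExoticAtlas) ∧
    ((∀ k : ℕ, 2 ≤ k → k < Module.finrank ℂ F →
        ∀ s : SuperModel.H0Obstruction V F E k, s = 1) →
      ∀ 𝔛 : SuperModel.Supermanifold V F E, ¬ 𝔛.AdmitsExoticAtlas) :=
  ⟨fun h => SuperModel.Supermanifold.not_admitsExoticAtlas fun k hk _ => h k hk,
    fun h => SuperModel.Supermanifold.not_admitsExoticAtlas h⟩
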